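/- Let $n\ge 1$, let $q$ be a measurable function on $\mathbb R^n$ with $0<p\le q(x)\le\overline q<\infty$, where $\underline q=\operatorname{ess\,inf} q$ and $\overline q=\operatorname{ess\,sup} q$, and let $v,w$ be weights on $\mathbb R^n$, i.e. measurable, non-negative, almost everywhere positive functions. Write $B(0,r)=\{y:|y|<r\}$ and, for measurable $\Omega\subset\mathbb R^n$, $$\|f\|_{L_{q(\cdot),w}(\Omega)}=\inf\Big\{\lambda>0:\int_\Omega\Big|\frac{f(x)w(x)}{\lambda}\Big|^{q(x)}dx\le1\Big\}\in[0,\infty],\qquad \inf\emptyset=\infty,$$ with $L_{q(\cdot)}=L_{q(\cdot),1}$. For measurable $f$ with $f>0$ almost everywhere let $$Gf(x)=\exp\Big(\frac1{|B(0,|x|)|}\int_{B(0,|x|)}\ln f(y)\,dy\Big)\in[0,\infty],$$ where the integral is $\int(\ln f)^+-\int(\ln f)^-\in[-\infty,\infty]$ (with $\infty-\infty=-\infty$), $\exp(-\infty)=0$ and $\exp(\infty)=\infty$. For $s>1$ put $$D(s,p,q)=\sup_{t>0}|B(0,t)|^{\frac{s-1}p}\,\Big\|\frac{w(\cdot)}{|B(0,|\cdot|)|^{s/p}}\,G\Big(\frac1v\Big)(\cdot)\Big\|_{L_{q(\cdot)}(|x|>t)}\in[0,\infty].$$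 Then there is a finite constant $C>0$ such that $$\|Gf\|_{L_{q(\cdot),w}(\mathbb R^n)}\le C\,\|f\|_{L_{p,v}(\mathbb R^n)}\quad\text{for every measurable } f>0\qquad(*)$$ if and only if $D(s,p,q)<\infty$ for some $s>1$; if $p>1$, this holds if and only if $D(s,p,q)<\infty$ for some $s\in(1,p)$. Moreover, the best constant $C$ in $(*)$, i.e. the infimum of all finite $C>0$ for which $(*)$ holds ($\infty$ if there is none), satisfies $$\sup_{s>1}\frac{e^{s/p}}{\big(e^s+\frac1{s-1}\big)^{1/p}}\,D(s,p,q)\le C\le\Big(\frac p{\underline q}+\frac{\overline q-p}{\overline q}\Big)^{2/p}\inf_{s>1}e^{\frac{s-1}p}D(s,p,q).$$ -/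

import Mathlib

open MeasureTheory
open scoped ENNReal NNReal

noncomputable section

/-- A weight: a Lebesgue measurable, non-negative, almost everywhere positive function. -/
structure IsWeight {n : ℕ} (w : EuclideanSpace ℝ (Fin n) → ℝ) : Prop where
  aemeasurable : AEMeasurable w volume
  nonneg : ∀ x, 0 ≤ w x
  ae_pos : ∀ᵐ x ∂(volume : Measure (EuclideanSpace ℝ (Fin n))), 0 < w x

/-- The Luxemburg functional of `L_{q(·),w}(Ω)`, for a function given by its absolute value
`F = |f|` in `[0,∞]`; it is `∞` exactly when no admissible scaling constant exists, that is,
when the function does not belong to the space. -/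
def luxNorm {n : ℕ} (q w : EuclideanSpace ℝ (Fin n) → ℝ) (Ω : Set (EuclideanSpace ℝ (Fin n)))
    (F : EuclideanSpace ℝ (Fin n) → ℝ≥0∞) : ℝ≥0∞ :=
  sInf {c : ℝ≥0∞ | 0 < c ∧ c < ⊤ ∧
    ∫⁻ x in Ω, (F x * ENNReal.ofReal (w x) / c) ^ (q x) ≤ 1}

/-- The integral of `ln f` over `A` in `[-∞,∞]`, as the integral of the positive part minus the
integral of the negative part. (If both are infinite, the value is `-∞`.) -/
def logIntegral {n : ℕ} (f : EuclideanSpace ℝ (Fin n) → ℝ)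
    (A : Set (EuclideanSpace ℝ (Fin n))) : EReal :=
  ((∫⁻ y in A, ENNReal.ofReal (Real.log (f y)) : ℝ≥0∞) : EReal) -
    ((∫⁻ y in A, ENNReal.ofReal (-Real.log (f y)) : ℝ≥0∞) : EReal)

/-- The geometric mean operator
`Gf(x) = exp (|B(0,|x|)|⁻¹ ∫_{B(0,|x|)} ln f)`, with values in `[0,∞]`. -/
def geomMean {n : ℕ} (f : EuclideanSpace ℝ (Fin n) → ℝ) (x : EuclideanSpace ℝ (Fin n)) : ℝ≥0∞ :=
  EReal.exp (logIntegral f (Metric.ball 0 ‖x‖) /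
    ((volume (Metric.ball (0 : EuclideanSpace ℝ (Fin n)) ‖x‖) : ℝ≥0∞) : EReal))

/-- The inequality `‖Gf‖_{L_{q(·),w}(ℝⁿ)} ≤ C ‖f‖_{L_{p,v}(ℝⁿ)}` for every measurable `f > 0`. -/
def GeomMeanInequality {n : ℕ} (p : ℝ) (q v w : EuclideanSpace ℝ (Fin n) → ℝ) (C : ℝ≥0∞) : Prop :=
  ∀ f : EuclideanSpace ℝ (Fin n) → ℝ, AEMeasurable f volume → (∀ x, 0 < f x) →
    luxNorm q w Set.univ (geomMean f) ≤ C * luxNorm (fun _ => p) v Set.univ (fun x => ‖f x‖ₑ)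

/-- The best constant: the infimum of all finite `C > 0` for which the inequality holds
(`∞` if there is none). -/
def bestConst {n : ℕ} (p : ℝ) (q v w : EuclideanSpace ℝ (Fin n) → ℝ) : ℝ≥0∞ :=
  sInf {C : ℝ≥0∞ | 0 < C ∧ C < ⊤ ∧ GeomMeanInequality p q v w C}

/-- `D(s,p,q) = sup_{t>0} |B(0,t)|^{(s-1)/p} ‖ w |B(0,|·|)|^{-s/p} G(1/v) ‖_{L_{q(·)}(|x|>t)}`. -/
def condD {n : ℕ} (s p : ℝ) (q v w : EuclideanSpace ℝ (Fin n) → ℝ) : ℝ≥0∞ :=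
  ⨆ (t : ℝ) (_ : 0 < t),
    volume (Metric.ball (0 : EuclideanSpace ℝ (Fin n)) t) ^ ((s - 1) / p) *
      luxNorm q (fun _ => 1) {x | t < ‖x‖}
        (fun x => ENNReal.ofReal (w x) /
          volume (Metric.ball (0 : EuclideanSpace ℝ (Fin n)) ‖x‖) ^ (s / p) *
            geomMean (fun y => 1 / v y) x)

end

/-!
For an integrable `h > 0`, Jensen's inequality bounds `G(|B(0,|·|)|^{s-1} h)(x)` by the mean of
`|B(0,|·|)|^{s-1} h` over `B(0,|x|)`, while `G(|B(0,|·|)|^{s-1})(x) = (|B(0,|x|)| / e)^{s-1}` and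
`G` is multiplicative. Applied to `h = (f v)^p` and multiplied by `G(1/v)`, this bounds `w Gf` by
`e^{(s-1)/p}` times a Hardy operator: the `L_p` norm over `|y| < |x|` of
`f(y) v(y) |B(0,|y|)|^{(s-1)/p}`, times the weight appearing in `D(s,p,q)`. If
`‖f‖_{L_{p,v}} ≤ λ`, then `(f v / λ)^p dy` has total mass at most one, so Jensen's inequality for
the exponents `p ≤ q(x)` and Tonelli's theorem reduce the `L_{q(·)}` norm of the Hardy operator to
the norms, for fixed `y`, of its kernel in `x`; each of these is at most `D(s,p,q)`.

Conversely, the inequality is tested on `f = v⁻¹ φ(|B(0,|·|)|)^{1/p}`, where `φ` is constant up to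
`|B(0,t)|` and decays like `u^{-s}` beyond it. Because `|B(0,|·|)|` pushes Lebesgue measure on `ℝⁿ`
forward to Lebesgue measure on `(0,∞)`, both `‖f‖_{L_{p,v}}` and `G(v f)` on `|x| > t` are
integrals of one real variable.
-/

section ErealIntegral

variable {α : Type*} [MeasurableSpace α] {μ : Measure α} {φ ψ : α → ℝ}

/-- The integral of a real function in `[-∞,∞]`, following the conventions of `logIntegral`: it is
`-∞` as soon as the negative part has infinite integral. -/
noncomputable def erealIntegral (μ : Measure α) (φ : α → ℝ) : EReal :=
  ((∫⁻ a, ENNReal.ofReal (φ a) ∂μ : ℝ≥0∞) : EReal) -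
    ((∫⁻ a, ENNReal.ofReal (-φ a) ∂μ : ℝ≥0∞) : EReal)

theorem erealIntegral_congr_ae (h : φ =ᵐ[μ] ψ) : erealIntegral μ φ = erealIntegral μ ψ := by
  have hpos := lintegral_congr_ae (h.mono fun a ha => congrArg ENNReal.ofReal ha)
  have hneg := lintegral_congr_ae (h.mono fun a ha => congrArg (fun r => ENNReal.ofReal (-r)) ha)
  rw [erealIntegral, erealIntegral, hpos, hneg]

theorem erealIntegral_eq_bot (h : ∫⁻ a, ENNReal.ofReal (-φ a) ∂μ = ⊤) :
    erealIntegral μ φ = ⊥ := by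
  rw [erealIntegral, h, EReal.coe_ennreal_top, EReal.sub_top]

theorem erealIntegral_eq_top (hpos : ∫⁻ a, ENNReal.ofReal (φ a) ∂μ = ⊤)
    (hneg : ∫⁻ a, ENNReal.ofReal (-φ a) ∂μ ≠ ⊤) : erealIntegral μ φ = ⊤ := by
  rw [erealIntegral, hpos, EReal.coe_ennreal_top]
  lift ∫⁻ a, ENNReal.ofReal (-φ a) ∂μ to ℝ≥0 using hneg with N
  exact EReal.top_sub_coe (N : ℝ)

theorem lintegral_ofReal_ne_top (hbot : erealIntegral μ φ ≠ ⊥) (htop : erealIntegral μ φ ≠ ⊤) :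
    ∫⁻ a, ENNReal.ofReal (φ a) ∂μ ≠ ⊤ := fun hpos =>
  htop (erealIntegral_eq_top hpos fun hneg => hbot (erealIntegral_eq_bot hneg))

theorem erealIntegral_eq_integral (h : Integrable φ μ) :
    erealIntegral μ φ = ((∫ a, φ a ∂μ : ℝ) : EReal) := by
  have hneg : ∫⁻ a, ENNReal.ofReal (-φ a) ∂μ ≠ ⊤ := h.neg.lintegral_lt_top.ne
  rw [erealIntegral, integral_eq_lintegral_pos_part_sub_lintegral_neg_part h, EReal.coe_sub,
    EReal.coe_ennreal_toReal h.lintegral_lt_top.ne, EReal.coe_ennreal_toReal hneg]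

theorem erealIntegral_const_mul {r : ℝ} (hr : 0 ≤ r) :
    erealIntegral μ (fun a => r * φ a) = r * erealIntegral μ φ := by
  rw [erealIntegral, erealIntegral,
    EReal.mul_sub_of_nonneg_of_ne_top (EReal.coe_nonneg.2 hr) (EReal.coe_ne_top r)]
  simp only [← mul_neg, ENNReal.ofReal_mul hr, lintegral_const_mul' _ _ ENNReal.ofReal_ne_top,
    EReal.coe_ennreal_mul, EReal.coe_ennreal_ofReal, max_eq_left hr]

theorem lintegral_ofReal_ne_top_of_le_add {ξ : α → ℝ} (hψ : AEMeasurable ψ μ)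
    (h : ∀ a, ξ a ≤ φ a + ψ a) (hφtop : ∫⁻ a, ENNReal.ofReal (φ a) ∂μ ≠ ⊤)
    (hψtop : ∫⁻ a, ENNReal.ofReal (ψ a) ∂μ ≠ ⊤) : ∫⁻ a, ENNReal.ofReal (ξ a) ∂μ ≠ ⊤ := by
  refine ne_top_of_le_ne_top (ENNReal.add_ne_top.2 ⟨hφtop, hψtop⟩) ?_
  rw [← lintegral_add_right' _ hψ.ennreal_ofReal]
  exact lintegral_mono fun a => (ENNReal.ofReal_le_ofReal (h a)).trans ENNReal.ofReal_add_le

theorem integrable_of_lintegral_ofReal_ne_top (hφ : AEMeasurable φ μ)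
    (hpos : ∫⁻ a, ENNReal.ofReal (φ a) ∂μ ≠ ⊤) (hneg : ∫⁻ a, ENNReal.ofReal (-φ a) ∂μ ≠ ⊤) :
    Integrable φ μ := by
  have habs_le : ∀ a, |φ a| ≤ max (φ a) 0 + max (-φ a) 0 := fun a =>
    (max_zero_add_max_neg_zero_eq_abs_self (φ a)).ge
  have habs := lintegral_ofReal_ne_top_of_le_add (μ := μ) (hφ.neg.max aemeasurable_const) habs_le
    (by simpa using hpos) (by simpa using hneg)
  exact (integrable_norm_iff hφ.aestronglyMeasurable).1 <|
    (lintegral_ofReal_ne_top_iff_integrable hφ.aestronglyMeasurable.norm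
      (ae_of_all _ fun a => norm_nonneg _)).1 habs

theorem erealIntegral_add (hφ : AEMeasurable φ μ) (hψ : AEMeasurable ψ μ)
    (hφpos : ∫⁻ a, ENNReal.ofReal (φ a) ∂μ ≠ ⊤)
    (h : erealIntegral μ φ ≠ ⊥ ∨ erealIntegral μ ψ ≠ ⊤) :
    erealIntegral μ (fun a => φ a + ψ a) = erealIntegral μ φ + erealIntegral μ ψ := by
  by_cases hneg : ∫⁻ a, ENNReal.ofReal (-(φ a + ψ a)) ∂μ = ⊤
  · rw [erealIntegral_eq_bot hneg]
    by_cases hφneg : ∫⁻ a, ENNReal.ofReal (-φ a) ∂μ = ⊤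
    · rw [erealIntegral_eq_bot hφneg, EReal.bot_add]
    · have hψneg : ∫⁻ a, ENNReal.ofReal (-ψ a) ∂μ = ⊤ := by
        by_contra hψneg
        exact lintegral_ofReal_ne_top_of_le_add hψ.neg (fun a => (neg_add _ _).le) hφneg hψneg hneg
      rw [erealIntegral_eq_bot hψneg, EReal.add_bot]
  have hψneg : ∫⁻ a, ENNReal.ofReal (-ψ a) ∂μ ≠ ⊤ :=
    lintegral_ofReal_ne_top_of_le_add hφ (fun a => by linarith) hneg hφpos
  by_cases hψpos : ∫⁻ a, ENNReal.ofReal (ψ a) ∂μ = ⊤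
  · have hφneg : ∫⁻ a, ENNReal.ofReal (-φ a) ∂μ ≠ ⊤ := fun hφneg =>
      h.elim (· (erealIntegral_eq_bot hφneg)) (· (erealIntegral_eq_top hψpos hψneg))
    have hpos : ∫⁻ a, ENNReal.ofReal (φ a + ψ a) ∂μ = ⊤ := by
      by_contra hpos
      exact lintegral_ofReal_ne_top_of_le_add hφ.neg
        (fun a => (add_neg_cancel_comm (φ a) (ψ a)).ge) hpos hφneg hψpos
    rw [erealIntegral_eq_top hpos hneg, erealIntegral_eq_top hψpos hψneg,
      erealIntegral_eq_integral (integrable_of_lintegral_ofReal_ne_top hφ hφpos hφneg),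
      EReal.coe_add_top]
  · have hφneg : ∫⁻ a, ENNReal.ofReal (-φ a) ∂μ ≠ ⊤ :=
      lintegral_ofReal_ne_top_of_le_add hψ (fun a => by linarith) hneg hψpos
    have hφi := integrable_of_lintegral_ofReal_ne_top hφ hφpos hφneg
    have hψi := integrable_of_lintegral_ofReal_ne_top hψ hψpos hψneg
    have hsum : Integrable (fun a => φ a + ψ a) μ := hφi.add hψi
    rw [erealIntegral_eq_integral hφi, erealIntegral_eq_integral hψi,
      erealIntegral_eq_integral hsum, integral_add hφi hψi, EReal.coe_add]

theorem exp_erealIntegral_div_le_laverage [IsFiniteMeasure μ] [NeZero μ] (hφ : AEMeasurable φ μ) :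
    EReal.exp (erealIntegral μ φ / (μ Set.univ : ℝ≥0∞)) ≤
      ⨍⁻ a, ENNReal.ofReal (Real.exp (φ a)) ∂μ := by
  have hμ0 : (0 : EReal) < (μ Set.univ : ℝ≥0∞) := by simpa using NeZero.ne μ
  have hμ : ((μ Set.univ : ℝ≥0∞) : EReal) ≠ ⊤ := by simp
  by_cases htop : ∫⁻ a, ENNReal.ofReal (Real.exp (φ a)) ∂μ = ⊤
  · rw [laverage_eq, htop, ENNReal.top_div_of_ne_top (measure_ne_top μ _)]
    exact le_top
  by_cases hneg : ∫⁻ a, ENNReal.ofReal (-φ a) ∂μ = ⊤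
  · rw [erealIntegral_eq_bot hneg, EReal.bot_div_of_pos_ne_top hμ0 hμ, EReal.exp_bot]
    exact zero_le
  have hpos : ∫⁻ a, ENNReal.ofReal (φ a) ∂μ ≠ ⊤ :=
    ne_top_of_le_ne_top htop <| lintegral_mono fun a =>
      ENNReal.ofReal_le_ofReal ((le_add_of_nonneg_right zero_le_one).trans (Real.add_one_le_exp _))
  have hφi := integrable_of_lintegral_ofReal_ne_top hφ hpos hneg
  have hexpi : Integrable (fun a => Real.exp (φ a)) μ :=
    (lintegral_ofReal_ne_top_iff_integrable hφ.exp.aestronglyMeasurable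
      (ae_of_all _ fun a => Real.exp_nonneg _)).1 htop
  have hjensen : Real.exp (⨍ a, φ a ∂μ) ≤ ⨍ a, Real.exp (φ a) ∂μ :=
    convexOn_exp.map_average_le Real.continuous_exp.continuousOn isClosed_univ
      (ae_of_all _ fun _ => Set.mem_univ _) hφi hexpi
  calc EReal.exp (erealIntegral μ φ / (μ Set.univ : ℝ≥0∞))
      = ENNReal.ofReal (Real.exp (⨍ a, φ a ∂μ)) := by
        rw [erealIntegral_eq_integral hφi, average_eq, smul_eq_mul, inv_mul_eq_div,
          ← EReal.exp_coe, EReal.coe_div, Measure.real,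
          EReal.coe_ennreal_toReal (measure_ne_top μ _)]
    _ ≤ ENNReal.ofReal (⨍ a, Real.exp (φ a) ∂μ) := ENNReal.ofReal_le_ofReal hjensen
    _ = ⨍⁻ a, ENNReal.ofReal (Real.exp (φ a)) ∂μ :=
        (ofReal_average hexpi (ae_of_all _ fun a => Real.exp_nonneg _)).trans (laverage_eq ..).symm

end ErealIntegral

/-- The measure of the open ball centred at the origin whose boundary passes through `y`; for
Lebesgue measure this is `|B(0,|y|)|`. -/
noncomputable def ballVol {E : Type*} [NormedAddCommGroup E] [MeasurableSpace E] (μ : Measure E)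
    (y : E) : ℝ :=
  μ.real (Metric.ball 0 ‖y‖)

section BallVol

variable {E : Type*} [NormedAddCommGroup E] [MeasurableSpace E] {μ : Measure E}

theorem ballVol_nonneg (y : E) : 0 ≤ ballVol μ y := measureReal_nonneg

variable [NormedSpace ℝ E] [FiniteDimensional ℝ E] [μ.IsAddHaarMeasure]

theorem ofReal_ballVol (y : E) : ENNReal.ofReal (ballVol μ y) = μ (Metric.ball 0 ‖y‖) :=
  ofReal_measureReal measure_ball_lt_top.ne

theorem measureReal_ball_zero_pos {r : ℝ} (hr : 0 < r) : 0 < μ.real (Metric.ball (0 : E) r) :=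
  ENNReal.toReal_pos (Metric.measure_ball_pos μ _ hr).ne' measure_ball_lt_top.ne

theorem ballVol_pos {y : E} (hy : y ≠ 0) : 0 < ballVol μ y :=
  measureReal_ball_zero_pos (norm_pos_iff.2 hy)

variable [BorelSpace E]

theorem measurable_ballVol : Measurable (ballVol μ) := by
  have hmono : Monotone fun r : ℝ => μ.real (Metric.ball (0 : E) r) := fun a b h =>
    measureReal_mono (Metric.ball_subset_ball h) measure_ball_lt_top.ne
  exact hmono.measurable.comp measurable_norm

variable [Nontrivial E]

theorem measureReal_ball_zero {r : ℝ} (hr : 0 ≤ r) :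
    μ.real (Metric.ball (0 : E) r) = r ^ Module.finrank ℝ E * μ.real (Metric.ball (0 : E) 1) := by
  rw [measureReal_def, Measure.addHaar_ball μ _ hr, ENNReal.toReal_mul,
    ENNReal.toReal_ofReal (by positivity), measureReal_def]

theorem strictMonoOn_measureReal_ball_zero :
    StrictMonoOn (fun r : ℝ => μ.real (Metric.ball (0 : E) r)) (Set.Ici 0) := by
  intro r hr t ht h
  simp only [measureReal_ball_zero hr, measureReal_ball_zero ht]
  exact mul_lt_mul_of_pos_right (pow_lt_pow_left₀ h hr Module.finrank_pos.ne')
    (measureReal_ball_zero_pos one_pos)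

theorem ballVol_lt_measureReal_ball {y : E} {r : ℝ} (hr : 0 ≤ r) :
    ballVol μ y < μ.real (Metric.ball 0 r) ↔ ‖y‖ < r :=
  strictMonoOn_measureReal_ball_zero.lt_iff_lt (norm_nonneg y) hr

theorem exists_measureReal_ball_eq (μ : Measure E) [μ.IsAddHaarMeasure] {b : ℝ} (hb : 0 ≤ b) :
    ∃ r, 0 ≤ r ∧ μ.real (Metric.ball (0 : E) r) = b := by
  have hunit : 0 < μ.real (Metric.ball (0 : E) 1) := measureReal_ball_zero_pos one_pos
  have hradius : 0 ≤ (b / μ.real (Metric.ball (0 : E) 1)) ^ ((Module.finrank ℝ E : ℝ)⁻¹) := by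
    positivity
  refine ⟨_, hradius, ?_⟩
  rw [measureReal_ball_zero hradius,
    Real.rpow_inv_natCast_pow (by positivity) Module.finrank_pos.ne', div_mul_cancel₀ _ hunit.ne']

theorem preimage_ballVol_Iio {r : ℝ} (hr : 0 ≤ r) :
    ballVol μ ⁻¹' Set.Iio (μ.real (Metric.ball (0 : E) r)) = Metric.ball 0 r := by
  ext y
  rw [Set.mem_preimage, Set.mem_Iio, ballVol_lt_measureReal_ball hr, mem_ball_zero_iff]

theorem map_ballVol : μ.map (ballVol μ) = volume.restrict (Set.Ioi 0) := by
  have hmap : ∀ b, μ.map (ballVol μ) (Set.Iio b) = ENNReal.ofReal b := by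
    intro b
    rw [Measure.map_apply measurable_ballVol measurableSet_Iio]
    rcases le_total b 0 with hb | hb
    · have hempty : ballVol μ ⁻¹' Set.Iio b = ∅ :=
        Set.eq_empty_of_forall_notMem fun y hy => (hb.trans (ballVol_nonneg y)).not_gt hy
      rw [hempty, measure_empty, ENNReal.ofReal_of_nonpos hb]
    · obtain ⟨r, hr, rfl⟩ := exists_measureReal_ball_eq μ hb
      rw [preimage_ballVol_Iio hr, ofReal_measureReal measure_ball_lt_top.ne]
  have hvol : ∀ b : ℝ, (volume : Measure ℝ).restrict (Set.Ioi 0) (Set.Iio b) =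
      ENNReal.ofReal b := by
    intro b
    rw [Measure.restrict_apply measurableSet_Iio, Set.Iio_inter_Ioi, Real.volume_Ioo, sub_zero]
  refine (Measure.ext_of_Ico _ _ fun a b hab => ?_).symm
  have hIco : Set.Ico a b = Set.Iio b \ Set.Iio a := by
    rw [Set.sdiff_eq, Set.compl_Iio, Set.inter_comm, Set.Ici_inter_Iio]
  rw [hIco, measure_sdiff (Set.Iio_subset_Iio hab.le)
      measurableSet_Iio.nullMeasurableSet (by simp [hvol]),
    measure_sdiff (Set.Iio_subset_Iio hab.le) measurableSet_Iio.nullMeasurableSet (by simp [hmap]),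
    hmap, hmap, hvol, hvol]

theorem map_ballVol_restrict_ball {r : ℝ} (hr : 0 ≤ r) :
    (μ.restrict (Metric.ball 0 r)).map (ballVol μ) =
      volume.restrict (Set.Ioo 0 (μ.real (Metric.ball (0 : E) r))) := by
  rw [← preimage_ballVol_Iio (μ := μ) hr,
    ← Measure.restrict_map measurable_ballVol measurableSet_Iio, map_ballVol,
    Measure.restrict_restrict measurableSet_Iio, preimage_ballVol_Iio hr, Set.Iio_inter_Ioi]

theorem integrableOn_ball_comp_ballVol {r : ℝ} (hr : 0 ≤ r) {φ : ℝ → ℝ}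
    (hφ : IntervalIntegrable φ volume 0 (μ.real (Metric.ball (0 : E) r))) :
    IntegrableOn (fun y => φ (ballVol μ y)) (Metric.ball 0 r) μ := by
  rw [intervalIntegrable_iff_integrableOn_Ioo_of_le measureReal_nonneg, IntegrableOn,
    ← map_ballVol_restrict_ball hr] at hφ
  exact hφ.comp_measurable measurable_ballVol

theorem setIntegral_ball_comp_ballVol {r : ℝ} (hr : 0 ≤ r) {φ : ℝ → ℝ}
    (hφ : IntervalIntegrable φ volume 0 (μ.real (Metric.ball (0 : E) r))) :
    ∫ y in Metric.ball 0 r, φ (ballVol μ y) ∂μ =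
      ∫ u in 0..μ.real (Metric.ball (0 : E) r), φ u := by
  rw [intervalIntegrable_iff_integrableOn_Ioo_of_le measureReal_nonneg, IntegrableOn] at hφ
  rw [intervalIntegral.integral_of_le measureReal_nonneg, integral_Ioc_eq_integral_Ioo,
    ← map_ballVol_restrict_ball hr, integral_map measurable_ballVol.aemeasurable]
  rw [map_ballVol_restrict_ball hr]
  exact hφ.aestronglyMeasurable

end BallVol

section GeomMean

variable {n : ℕ} {f g : EuclideanSpace ℝ (Fin n) → ℝ} {x : EuclideanSpace ℝ (Fin n)}

theorem geomMean_eq_exp_erealIntegral (f : EuclideanSpace ℝ (Fin n) → ℝ)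
    (x : EuclideanSpace ℝ (Fin n)) :
    geomMean f x =
      EReal.exp (erealIntegral (volume.restrict (Metric.ball 0 ‖x‖)) (fun y => Real.log (f y)) /
        (ballVol volume x : ℝ)) := by
  rw [← max_eq_left (ballVol_nonneg (μ := volume) x), ← EReal.coe_ennreal_ofReal, ofReal_ballVol]
  rfl

theorem geomMean_congr_ae (h : f =ᵐ[volume] g) : geomMean f = geomMean g := by
  funext x
  have hlog : (fun y => Real.log (f y)) =ᵐ[volume] fun y => Real.log (g y) := h.fun_comp Real.log
  rw [geomMean_eq_exp_erealIntegral, geomMean_eq_exp_erealIntegral,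
    erealIntegral_congr_ae (ae_restrict_of_ae hlog)]

theorem geomMean_eq_zero (hx : x ≠ 0)
    (h : erealIntegral (volume.restrict (Metric.ball 0 ‖x‖)) (fun y => Real.log (f y)) = ⊥) :
    geomMean f x = 0 := by
  rw [geomMean_eq_exp_erealIntegral, h, EReal.bot_div_of_pos_ne_top
    (EReal.coe_pos.2 (ballVol_pos hx)) (EReal.coe_ne_top _), EReal.exp_bot]

theorem geomMean_eq_top (hx : x ≠ 0)
    (h : erealIntegral (volume.restrict (Metric.ball 0 ‖x‖)) (fun y => Real.log (f y)) = ⊤) :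
    geomMean f x = ⊤ := by
  rw [geomMean_eq_exp_erealIntegral, h, EReal.top_div_of_pos_ne_top
    (EReal.coe_pos.2 (ballVol_pos hx)) (EReal.coe_ne_top _), EReal.exp_top]

theorem geomMean_eq_ofReal_exp
    (hf : IntegrableOn (fun y => Real.log (f y)) (Metric.ball 0 ‖x‖)) :
    geomMean f x = ENNReal.ofReal
      (Real.exp ((∫ y in Metric.ball 0 ‖x‖, Real.log (f y)) / ballVol volume x)) := by
  rw [geomMean_eq_exp_erealIntegral, erealIntegral_eq_integral hf, ← EReal.coe_div, EReal.exp_coe]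

theorem geomMean_rpow (hf : ∀ᵐ y ∂volume, 0 < f y) {r : ℝ} (hr : 0 ≤ r) :
    geomMean (fun y => f y ^ r) x = geomMean f x ^ r := by
  have hlog : (fun y => Real.log (f y ^ r)) =ᵐ[volume] fun y => r * Real.log (f y) :=
    hf.mono fun y hy => Real.log_rpow hy r
  rw [geomMean_eq_exp_erealIntegral, erealIntegral_congr_ae (ae_restrict_of_ae hlog),
    erealIntegral_const_mul hr, ← EReal.mul_div, mul_comm, EReal.exp_mul,
    ← geomMean_eq_exp_erealIntegral]

theorem geomMean_mul (hx : x ≠ 0) (hfm : AEMeasurable f volume) (hgm : AEMeasurable g volume)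
    (hf : ∀ᵐ y ∂volume, 0 < f y) (hg : ∀ᵐ y ∂volume, 0 < g y)
    (hpos : ∫⁻ y in Metric.ball 0 ‖x‖, ENNReal.ofReal (Real.log (f y)) ≠ ⊤)
    (h : geomMean f x ≠ 0 ∨ geomMean g x ≠ ⊤) :
    geomMean (fun y => f y * g y) x = geomMean f x * geomMean g x := by
  have hlog : (fun y => Real.log (f y * g y)) =ᵐ[volume]
      fun y => Real.log (f y) + Real.log (g y) := by
    filter_upwards [hf, hg] with y hfy hgy
    exact Real.log_mul hfy.ne' hgy.ne'
  rw [geomMean_eq_exp_erealIntegral, erealIntegral_congr_ae (ae_restrict_of_ae hlog),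
    erealIntegral_add hfm.restrict.log hgm.restrict.log hpos
      (h.imp (mt (geomMean_eq_zero hx)) (mt (geomMean_eq_top hx))),
    EReal.add_div_of_nonneg_right (EReal.coe_nonneg.2 (ballVol_nonneg x)), EReal.exp_add,
    ← geomMean_eq_exp_erealIntegral, ← geomMean_eq_exp_erealIntegral]

theorem geomMean_mul_of_ne_zero_of_ne_top (hx : x ≠ 0) (hfm : AEMeasurable f volume)
    (hgm : AEMeasurable g volume) (hf : ∀ᵐ y ∂volume, 0 < f y) (hg : ∀ᵐ y ∂volume, 0 < g y)
    (hzero : geomMean f x ≠ 0) (htop : geomMean f x ≠ ⊤) :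
    geomMean (fun y => f y * g y) x = geomMean f x * geomMean g x :=
  geomMean_mul hx hfm hgm hf hg
    (lintegral_ofReal_ne_top (mt (geomMean_eq_zero hx) hzero) (mt (geomMean_eq_top hx) htop))
    (Or.inl hzero)

theorem geomMean_le_lintegral_div (hx : x ≠ 0) (hfm : AEMeasurable f volume)
    (hf : ∀ᵐ y ∂volume, 0 < f y) :
    geomMean f x ≤
      (∫⁻ y in Metric.ball 0 ‖x‖, ENNReal.ofReal (f y)) /
        volume (Metric.ball (0 : EuclideanSpace ℝ (Fin n)) ‖x‖) := by
  have : NeZero (volume.restrict (Metric.ball (0 : EuclideanSpace ℝ (Fin n)) ‖x‖)) :=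
    ⟨Measure.restrict_eq_zero.not.2 (Metric.measure_ball_pos _ _ (norm_pos_iff.2 hx)).ne'⟩
  have : IsFiniteMeasure (volume.restrict (Metric.ball (0 : EuclideanSpace ℝ (Fin n)) ‖x‖)) :=
    isFiniteMeasure_restrict.2 measure_ball_lt_top.ne
  have hjensen := exp_erealIntegral_div_le_laverage (μ := volume.restrict (Metric.ball 0 ‖x‖))
    hfm.restrict.log
  have hexp : (fun y => ENNReal.ofReal (Real.exp (Real.log (f y)))) =ᵐ[volume]
      fun y => ENNReal.ofReal (f y) :=
    hf.mono fun y hy => congrArg ENNReal.ofReal (Real.exp_log hy)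
  rwa [laverage_eq, lintegral_congr_ae (ae_restrict_of_ae hexp),
    Measure.restrict_apply_univ] at hjensen

theorem measurable_geomMean (f : EuclideanSpace ℝ (Fin n) → ℝ) : Measurable (geomMean f) := by
  have hmono : ∀ φ : EuclideanSpace ℝ (Fin n) → ℝ≥0∞,
      Monotone fun r : ℝ => ∫⁻ y in Metric.ball 0 r, φ y :=
    fun φ a b h => lintegral_mono_set (Metric.ball_subset_ball h)
  have hball : ∀ φ : EuclideanSpace ℝ (Fin n) → ℝ≥0∞,
      Measurable fun x : EuclideanSpace ℝ (Fin n) => ∫⁻ y in Metric.ball 0 ‖x‖, φ y :=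
    fun φ => (hmono φ).measurable.comp measurable_norm
  have hV := measurable_ballVol (μ := (volume : Measure (EuclideanSpace ℝ (Fin n))))
  simp only [funext (geomMean_eq_exp_erealIntegral f), erealIntegral, sub_eq_add_neg,
    div_eq_mul_inv, ← EReal.coe_inv]
  exact (((hball _).coe_ereal_ennreal.add (hball _).coe_ereal_ennreal.neg).mul
    hV.inv.coe_real_ereal).ereal_exp

section RadialFunctions

variable [NeZero n]

theorem geomMean_comp_ballVol {φ : ℝ → ℝ}
    (hφ : IntervalIntegrable (fun u => Real.log (φ u)) volume 0 (ballVol volume x)) :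
    geomMean (fun y => φ (ballVol volume y)) x =
      ENNReal.ofReal
        (Real.exp ((∫ u in 0..ballVol volume x, Real.log (φ u)) / ballVol volume x)) := by
  have hint := integrableOn_ball_comp_ballVol (φ := fun u => Real.log (φ u)) (norm_nonneg x) hφ
  rw [geomMean_eq_ofReal_exp hint,
    setIntegral_ball_comp_ballVol (φ := fun u => Real.log (φ u)) (norm_nonneg x) hφ, ballVol]

theorem ae_ballVol_pos (n : ℕ) [NeZero n] :
    ∀ᵐ y ∂(volume : Measure (EuclideanSpace ℝ (Fin n))), 0 < ballVol volume y :=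
  (Measure.ae_ne volume 0).mono fun _ hy => ballVol_pos hy

theorem geomMean_ballVol (hx : x ≠ 0) :
    geomMean (ballVol volume) x = ENNReal.ofReal (ballVol volume x / Real.exp 1) := by
  have hV : 0 < ballVol volume x := ballVol_pos hx
  rw [geomMean_comp_ballVol (φ := fun u => u) intervalIntegral.intervalIntegrable_log',
    integral_log_from_zero, sub_div, mul_div_cancel_left₀ _ hV.ne', div_self hV.ne',
    Real.exp_sub, Real.exp_log hV]

end RadialFunctions

end GeomMean

section MixedNorm

variable {X Y : Type*} [MeasurableSpace X] [MeasurableSpace Y] {μ : Measure X} {ν : Measure Y}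

theorem lintegral_pos_of_ae_pos [NeZero μ] {F : X → ℝ≥0∞} (hF : AEMeasurable F μ)
    (h : ∀ᵐ x ∂μ, 0 < F x) : 0 < ∫⁻ x, F x ∂μ := by
  refine pos_iff_ne_zero.2 fun hzero => ?_
  obtain ⟨x, hx0, hx⟩ := (((lintegral_eq_zero_iff' hF).1 hzero).and h).exists
  exact hx.ne' hx0

theorem lintegral_const_mul_rpow_one_div {p : ℝ} (hp : 0 < p) {k : ℝ≥0∞} (hk : k ≠ ⊤)
    {F : Y → ℝ≥0∞} :
    (∫⁻ y, (k * F y) ^ p ∂ν) ^ (1 / p) = k * (∫⁻ y, F y ^ p ∂ν) ^ (1 / p) := by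
  simp only [ENNReal.mul_rpow_of_nonneg _ _ hp.le]
  rw [lintegral_const_mul' _ _ (ENNReal.rpow_ne_top_of_nonneg hp.le hk),
    ENNReal.mul_rpow_of_nonneg _ _ (one_div_nonneg.2 hp.le), ← ENNReal.rpow_mul,
    mul_one_div_cancel hp.ne', ENNReal.rpow_one]

theorem rpow_lintegral_rpow_le_lintegral_rpow {p r : ℝ} (hν : ν Set.univ ≤ 1) (hp : 0 < p)
    (hpr : p ≤ r) {F : Y → ℝ≥0∞} (hF : AEMeasurable F ν) :
    ((∫⁻ y, F y ^ p ∂ν) ^ (1 / p)) ^ r ≤ ∫⁻ y, F y ^ r ∂ν := by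
  have hr : 0 < r := hp.trans_le hpr
  have hmass : ν Set.univ ^ (1 / p - 1 / r) ≤ 1 :=
    ENNReal.rpow_le_one hν (sub_nonneg.2 (one_div_le_one_div_of_le hp hpr))
  have hLp : (∫⁻ y, F y ^ p ∂ν) ^ (1 / p) ≤ (∫⁻ y, F y ^ r ∂ν) ^ (1 / r) := by
    have h := (eLpNorm'_le_eLpNorm'_mul_rpow_measure_univ hp hpr hF.aestronglyMeasurable).trans
      (mul_le_of_le_one_right' hmass)
    simpa only [eLpNorm', enorm_eq_self] using h
  calc ((∫⁻ y, F y ^ p ∂ν) ^ (1 / p)) ^ r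
      ≤ ((∫⁻ y, F y ^ r ∂ν) ^ (1 / r)) ^ r := ENNReal.rpow_le_rpow hLp hr.le
    _ = ∫⁻ y, F y ^ r ∂ν := by
      rw [← ENNReal.rpow_mul, one_div_mul_cancel hr.ne', ENNReal.rpow_one]

theorem lintegral_rpow_lintegral_rpow_le_one [SFinite μ] [SFinite ν] {p : ℝ} {q : X → ℝ}
    {K : X → Y → ℝ≥0∞} (hν : ν Set.univ ≤ 1) (hp : 0 < p) (hq : AEMeasurable q μ)
    (hpq : ∀ᵐ x ∂μ, p ≤ q x) (hK : AEMeasurable (Function.uncurry K) (μ.prod ν))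
    (hmod : ∀ᵐ y ∂ν, ∫⁻ x, K x y ^ q x ∂μ ≤ 1) :
    ∫⁻ x, ((∫⁻ y, K x y ^ p ∂ν) ^ (1 / p)) ^ q x ∂μ ≤ 1 := by
  have hslice : ∀ᵐ x ∂μ, AEMeasurable (K x) ν :=
    hK.aestronglyMeasurable.prodMk_left.mono fun _ hx => hx.aemeasurable
  calc ∫⁻ x, ((∫⁻ y, K x y ^ p ∂ν) ^ (1 / p)) ^ q x ∂μ
      ≤ ∫⁻ x, ∫⁻ y, K x y ^ q x ∂ν ∂μ := by
        refine lintegral_mono_ae ?_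
        filter_upwards [hslice, hpq] with x hx hpx
        exact rpow_lintegral_rpow_le_lintegral_rpow hν hp hpx hx
    _ = ∫⁻ y, ∫⁻ x, K x y ^ q x ∂μ ∂ν :=
        lintegral_lintegral_swap (hK.pow hq.comp_fst)
    _ ≤ ∫⁻ _, 1 ∂ν := lintegral_mono_ae hmod
    _ ≤ 1 := by rwa [lintegral_one]

end MixedNorm

section LuxNorm

variable {n : ℕ} {q w : EuclideanSpace ℝ (Fin n) → ℝ} {Ω Ω' : Set (EuclideanSpace ℝ (Fin n))}
  {F G : EuclideanSpace ℝ (Fin n) → ℝ≥0∞} {c : ℝ≥0∞}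

theorem luxNorm_eq_luxNorm_one :
    luxNorm q w Ω F = luxNorm q (fun _ => 1) Ω fun x => F x * ENNReal.ofReal (w x) := by
  simp only [luxNorm, ENNReal.ofReal_one, mul_one]

theorem luxNorm_le (hc : 0 < c) (hctop : c < ⊤)
    (h : ∫⁻ x in Ω, (F x * ENNReal.ofReal (w x) / c) ^ q x ≤ 1) : luxNorm q w Ω F ≤ c :=
  sInf_le ⟨hc, hctop, h⟩

theorem lintegral_le_one_of_luxNorm_lt (hq : ∀ᵐ x ∂volume, 0 ≤ q x) (h : luxNorm q w Ω F < c) :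
    ∫⁻ x in Ω, (F x * ENNReal.ofReal (w x) / c) ^ q x ≤ 1 := by
  obtain ⟨d, ⟨-, -, hd⟩, hdc⟩ := sInf_lt_iff.1 h
  refine (lintegral_mono_ae (ae_restrict_of_ae (hq.mono fun x hx => ?_))).trans hd
  gcongr

theorem luxNorm_mono_ae (hq : ∀ᵐ x ∂volume, 0 ≤ q x)
    (h : ∀ᵐ x ∂volume, F x * ENNReal.ofReal (w x) ≤ G x * ENNReal.ofReal (w x)) :
    luxNorm q w Ω F ≤ luxNorm q w Ω G := by
  refine sInf_le_sInf fun c ⟨hc, hctop, hmod⟩ => ⟨hc, hctop, le_trans ?_ hmod⟩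
  refine lintegral_mono_ae (ae_restrict_of_ae ?_)
  filter_upwards [hq, h] with x hqx hx
  gcongr

theorem luxNorm_congr (hΩ : MeasurableSet Ω) (h : Set.EqOn F G Ω) :
    luxNorm q w Ω F = luxNorm q w Ω G := by
  have hmod : ∀ c : ℝ≥0∞, ∫⁻ x in Ω, (F x * ENNReal.ofReal (w x) / c) ^ q x =
      ∫⁻ x in Ω, (G x * ENNReal.ofReal (w x) / c) ^ q x := fun c =>
    setLIntegral_congr_fun hΩ fun x hx => by simp only [h hx]
  simp only [luxNorm, hmod]

theorem luxNorm_mono_set (h : Ω ⊆ Ω') : luxNorm q w Ω F ≤ luxNorm q w Ω' F :=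
  sInf_le_sInf fun _ ⟨hc, hctop, hmod⟩ => ⟨hc, hctop, (lintegral_mono_set h).trans hmod⟩

theorem luxNorm_univ_indicator (hq : ∀ᵐ x ∂volume, 0 < q x) (hΩ : MeasurableSet Ω) :
    luxNorm q w Set.univ (Ω.indicator F) = luxNorm q w Ω F := by
  have hmod : ∀ c : ℝ≥0∞, ∫⁻ x in Set.univ, (Ω.indicator F x * ENNReal.ofReal (w x) / c) ^ q x =
      ∫⁻ x in Ω, (F x * ENNReal.ofReal (w x) / c) ^ q x := by
    intro c
    rw [Measure.restrict_univ, ← lintegral_indicator hΩ]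
    refine lintegral_congr_ae (hq.mono fun x hx => ?_)
    by_cases hxΩ : x ∈ Ω <;> simp [hxΩ, hx]
  simp only [luxNorm, hmod]

theorem luxNorm_const_mul_le {k : ℝ≥0∞} (hk : k ≠ 0) (hktop : k ≠ ⊤) :
    luxNorm q w Ω (fun x => k * F x) ≤ k * luxNorm q w Ω F := by
  rw [luxNorm, luxNorm, sInf_eq_iInf' (s := {c | _}), sInf_eq_iInf' (s := {c | _}),
    ENNReal.mul_iInf_of_ne hk hktop, ← sInf_eq_iInf']
  refine le_iInf fun ⟨c, hc, hctop, hmod⟩ => sInf_le ⟨ENNReal.mul_pos hk hc.ne',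
    ENNReal.mul_lt_top hktop.lt_top hctop, ?_⟩
  simpa only [mul_assoc, ENNReal.mul_div_mul_left _ _ hk hktop] using hmod

theorem luxNorm_const_mul {k : ℝ≥0∞} (hk : k ≠ 0) (hktop : k ≠ ⊤) :
    luxNorm q w Ω (fun x => k * F x) = k * luxNorm q w Ω F := by
  refine le_antisymm (luxNorm_const_mul_le hk hktop) ?_
  calc k * luxNorm q w Ω F
      = k * luxNorm q w Ω (fun x => k⁻¹ * (k * F x)) := by
        simp only [ENNReal.inv_mul_cancel_left hk hktop]
    _ ≤ k * (k⁻¹ * luxNorm q w Ω fun x => k * F x) := by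
        gcongr
        exact luxNorm_const_mul_le (ENNReal.inv_ne_zero.2 hktop) (ENNReal.inv_ne_top.2 hk)
    _ = luxNorm q w Ω fun x => k * F x := ENNReal.mul_inv_cancel_left hk hktop

theorem luxNorm_rpow_lintegral_rpow_le {Y : Type*} [MeasurableSpace Y] {ν : Measure Y} [SFinite ν]
    {p : ℝ} {K : EuclideanSpace ℝ (Fin n) → Y → ℝ≥0∞} {D : ℝ≥0∞} (hν : ν Set.univ ≤ 1)
    (hp : 0 < p) (hq : AEMeasurable q volume) (hpq : ∀ᵐ x ∂volume, p ≤ q x)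
    (hK : AEMeasurable (Function.uncurry K) (volume.prod ν))
    (hD : ∀ᵐ y ∂ν, luxNorm q (fun _ => 1) Set.univ (fun x => K x y) ≤ D) :
    luxNorm q (fun _ => 1) Set.univ (fun x => (∫⁻ y, K x y ^ p ∂ν) ^ (1 / p)) ≤ D := by
  have hq0 : ∀ᵐ x ∂volume, 0 ≤ q x := hpq.mono fun x hx => hp.le.trans hx
  refine le_of_forall_gt_imp_ge_of_dense fun c hc => ?_
  rcases eq_or_ne c ⊤ with rfl | hctop
  · exact le_top
  have hc0 : c ≠ 0 := (zero_le.trans_lt hc).ne'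
  have hmod : ∀ᵐ y ∂ν, ∫⁻ x, (c⁻¹ * K x y) ^ q x ≤ 1 := hD.mono fun y hy => by
    simpa only [ENNReal.ofReal_one, mul_one, Measure.restrict_univ, ENNReal.div_eq_inv_mul] using
      lintegral_le_one_of_luxNorm_lt hq0 (hy.trans_lt hc)
  refine luxNorm_le hc0.bot_lt hctop.lt_top ?_
  simpa only [ENNReal.ofReal_one, mul_one, Measure.restrict_univ, ENNReal.div_eq_inv_mul,
    lintegral_const_mul_rpow_one_div hp (ENNReal.inv_ne_top.2 hc0)] using
    lintegral_rpow_lintegral_rpow_le_one (K := fun x y => c⁻¹ * K x y) hν hp hq hpq (hK.const_mul _)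
      hmod

end LuxNorm

section UpperBound

variable {n : ℕ} {s p : ℝ} {f v w : EuclideanSpace ℝ (Fin n) → ℝ}
  {x : EuclideanSpace ℝ (Fin n)}

/-- The weight `w |B(0,|·|)|^{-s/p} G(1/v)` of `condD`, which is also the outer weight of the Hardy
operator that dominates `G`. -/
noncomputable def hardyWeight (s p : ℝ) (v w : EuclideanSpace ℝ (Fin n) → ℝ)
    (x : EuclideanSpace ℝ (Fin n)) : ℝ≥0∞ :=
  ENNReal.ofReal (w x) /
    ENNReal.ofReal (ballVol volume x) ^ (s / p) *
      geomMean (fun y => 1 / v y) x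

/-- The kernel `1_{|y|<|x|} |B(0,|y|)|^{(s-1)/p} hardyWeight(x)`; its `L_{q(·)}` norms in `x` are
the quantities whose supremum is `condD`. -/
noncomputable def hardyKernel (s p : ℝ) (v w : EuclideanSpace ℝ (Fin n) → ℝ)
    (x y : EuclideanSpace ℝ (Fin n)) : ℝ≥0∞ :=
  {x | ‖y‖ < ‖x‖}.indicator
    (fun x => ENNReal.ofReal (ballVol volume y) ^ ((s - 1) / p) *
      hardyWeight s p v w x) x

theorem condD_eq_iSup_luxNorm_hardyWeight {q : EuclideanSpace ℝ (Fin n) → ℝ} :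
    condD s p q v w = ⨆ (t : ℝ) (_ : 0 < t),
      volume (Metric.ball (0 : EuclideanSpace ℝ (Fin n)) t) ^ ((s - 1) / p) *
        luxNorm q (fun _ => 1) {x | t < ‖x‖} (hardyWeight s p v w) := by
  simp only [condD, ← ofReal_ballVol]
  rfl

theorem aemeasurable_hardyWeight (hw : AEMeasurable w volume) :
    AEMeasurable (hardyWeight s p v w) volume :=
  (hw.ennreal_ofReal.div (measurable_ballVol.ennreal_ofReal.pow_const _).aemeasurable).mul
    (measurable_geomMean _).aemeasurable

theorem aemeasurable_uncurry_hardyKernel (hw : AEMeasurable w volume)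
    {ν : Measure (EuclideanSpace ℝ (Fin n))} :
    AEMeasurable (Function.uncurry (hardyKernel s p v w)) (volume.prod ν) :=
  (((measurable_ballVol.ennreal_ofReal.pow_const _).comp measurable_snd).aemeasurable.mul
    (aemeasurable_hardyWeight hw).comp_fst).indicator
      (measurableSet_lt measurable_snd.norm measurable_fst.norm)

theorem rpow_lintegral_hardyKernel_withDensity (hp : 0 < p)
    {φ : EuclideanSpace ℝ (Fin n) → ℝ≥0∞} (hφ : AEMeasurable φ volume) :
    (∫⁻ y, hardyKernel s p v w x y ^ p ∂volume.withDensity fun y => φ y ^ p) ^ (1 / p) =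
      hardyWeight s p v w x * (∫⁻ y in Metric.ball 0 ‖x‖,
        (φ y * ENNReal.ofReal (ballVol volume y) ^ ((s - 1) / p)) ^ p) ^ (1 / p) := by
  have hkernel : (fun y => hardyKernel s p v w x y ^ p) = (Metric.ball 0 ‖x‖).indicator
      fun y => hardyWeight s p v w x ^ p *
        (ENNReal.ofReal (ballVol volume y) ^ ((s - 1) / p)) ^ p := by
    funext y
    by_cases hy : ‖y‖ < ‖x‖ <;>
      simp [hardyKernel, hy, hp, ENNReal.mul_rpow_of_nonneg _ _ hp.le, mul_comm]
  have hV : Measurable fun y : EuclideanSpace ℝ (Fin n) =>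
      (ENNReal.ofReal (ballVol volume y) ^ ((s - 1) / p)) ^ p :=
    (measurable_ballVol.ennreal_ofReal.pow_const _).pow_const _
  rw [hkernel, lintegral_indicator Metric.isOpen_ball.measurableSet, lintegral_const_mul _ hV,
    setLIntegral_withDensity_eq_lintegral_mul₀ (hφ.pow_const p) hV.aemeasurable
      Metric.isOpen_ball.measurableSet,
    ENNReal.mul_rpow_of_nonneg _ _ (one_div_nonneg.2 hp.le), ← ENNReal.rpow_mul,
    mul_one_div_cancel hp.ne', ENNReal.rpow_one]
  simp only [Pi.mul_apply, ENNReal.mul_rpow_of_nonneg _ _ hp.le]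

theorem luxNorm_hardyKernel_le_condD {q : EuclideanSpace ℝ (Fin n) → ℝ}
    {y : EuclideanSpace ℝ (Fin n)} (hy : y ≠ 0) (hq : ∀ᵐ x ∂volume, 0 < q x) :
    luxNorm q (fun _ => 1) Set.univ (fun x => hardyKernel s p v w x y) ≤ condD s p q v w := by
  have hV : ENNReal.ofReal (ballVol volume y) ≠ 0 := (ENNReal.ofReal_pos.2 (ballVol_pos hy)).ne'
  calc luxNorm q (fun _ => 1) Set.univ (fun x => hardyKernel s p v w x y)
      = luxNorm q (fun _ => 1) {x | ‖y‖ < ‖x‖} fun x =>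
          ENNReal.ofReal (ballVol volume y) ^ ((s - 1) / p) *
            hardyWeight s p v w x :=
        luxNorm_univ_indicator hq (measurableSet_lt measurable_const measurable_norm)
    _ ≤ ENNReal.ofReal (ballVol volume y) ^ ((s - 1) / p) *
          luxNorm q (fun _ => 1) {x | ‖y‖ < ‖x‖} (hardyWeight s p v w) :=
        luxNorm_const_mul_le (by simp [hV]) (by simp [hV])
    _ ≤ condD s p q v w := by
        rw [condD_eq_iSup_luxNorm_hardyWeight, ofReal_ballVol]
        exact le_iSup₂_of_le ‖y‖ (norm_pos_iff.2 hy) le_rfl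

variable [NeZero n]

theorem ballVol_rpow_mul_geomMean_le (hx : x ≠ 0) (hs : 1 ≤ s) (hfm : AEMeasurable f volume)
    (hf : ∀ᵐ y ∂volume, 0 < f y) :
    ENNReal.ofReal (ballVol volume x) ^ s * geomMean f x ≤ ENNReal.ofReal (Real.exp (s - 1)) *
      ∫⁻ y in Metric.ball 0 ‖x‖, ENNReal.ofReal (ballVol volume y ^ (s - 1) * f y) := by
  have hs0 : 0 ≤ s - 1 := sub_nonneg.2 hs
  have hV : 0 < ballVol volume x := ballVol_pos hx
  have hpower : geomMean (fun y => ballVol volume y ^ (s - 1)) x =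
      ENNReal.ofReal ((ballVol volume x / Real.exp 1) ^ (s - 1)) := by
    rw [geomMean_rpow (ae_ballVol_pos n) hs0, geomMean_ballVol hx,
      ENNReal.ofReal_rpow_of_nonneg (by positivity) hs0]
  have hpower_meas : AEMeasurable
      (fun y : EuclideanSpace ℝ (Fin n) => ballVol volume y ^ (s - 1)) volume :=
    (measurable_ballVol.pow_const _).aemeasurable
  have hpower_pos : ∀ᵐ y : EuclideanSpace ℝ (Fin n), 0 < ballVol volume y ^ (s - 1) :=
    (ae_ballVol_pos n).mono fun y hy => Real.rpow_pos_of_pos hy _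
  have hmean : ENNReal.ofReal ((ballVol volume x / Real.exp 1) ^ (s - 1)) * geomMean f x ≤
      (∫⁻ y in Metric.ball 0 ‖x‖, ENNReal.ofReal (ballVol volume y ^ (s - 1) * f y)) /
        ENNReal.ofReal (ballVol volume x) := by
    rw [← hpower, ofReal_ballVol,
      ← geomMean_mul_of_ne_zero_of_ne_top hx hpower_meas hfm hpower_pos hf
        (by rw [hpower]; positivity) (by rw [hpower]; exact ENNReal.ofReal_ne_top)]
    exact geomMean_le_lintegral_div hx (hpower_meas.mul hfm)
      (hpower_pos.mp (hf.mono fun y hfy hVy => mul_pos hVy hfy))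
  have hconst : ENNReal.ofReal (ballVol volume x) ^ s = ENNReal.ofReal (Real.exp (s - 1)) *
      (ENNReal.ofReal (ballVol volume x) *
        ENNReal.ofReal ((ballVol volume x / Real.exp 1) ^ (s - 1))) := by
    rw [ENNReal.ofReal_rpow_of_pos hV, ← ENNReal.ofReal_mul hV.le,
      ← ENNReal.ofReal_mul (Real.exp_nonneg _), Real.div_rpow hV.le (Real.exp_nonneg _),
      Real.exp_one_rpow, mul_div_assoc', mul_div_cancel₀ _ (Real.exp_ne_zero _),
      Real.rpow_sub_one hV.ne', mul_div_cancel₀ _ hV.ne']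
  rw [hconst, mul_assoc, mul_assoc]
  gcongr
  exact ENNReal.mul_le_of_le_div' hmean

theorem geomMean_le_rpow_lintegral (hx : x ≠ 0) (hp : 0 < p) (hs : 1 ≤ s)
    (hfm : AEMeasurable f volume) (hf : ∀ᵐ y ∂volume, 0 < f y) :
    geomMean f x ≤
      ENNReal.ofReal (Real.exp ((s - 1) / p)) / ENNReal.ofReal (ballVol volume x) ^ (s / p) *
        (∫⁻ y in Metric.ball 0 ‖x‖,
          (ENNReal.ofReal (f y) * ENNReal.ofReal (ballVol volume y) ^ ((s - 1) / p)) ^ p) ^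
            (1 / p) := by
  have hV : ENNReal.ofReal (ballVol volume x) ≠ 0 := (ENNReal.ofReal_pos.2 (ballVol_pos hx)).ne'
  have hintegrand : (fun y => ENNReal.ofReal (ballVol volume y ^ (s - 1) * f y ^ p)) =ᵐ[volume]
      fun y => (ENNReal.ofReal (f y) * ENNReal.ofReal (ballVol volume y) ^ ((s - 1) / p)) ^ p := by
    filter_upwards [hf] with y hy
    rw [ENNReal.mul_rpow_of_nonneg _ _ hp.le, ← ENNReal.rpow_mul, div_mul_cancel₀ _ hp.ne',
      ENNReal.ofReal_mul' (by positivity), ENNReal.ofReal_rpow_of_pos hy,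
      ENNReal.ofReal_rpow_of_nonneg (ballVol_nonneg y) (sub_nonneg.2 hs), mul_comm]
  have hpow := ballVol_rpow_mul_geomMean_le hx hs (hfm.pow_const p)
    (hf.mono fun y hy => Real.rpow_pos_of_pos hy p)
  rw [geomMean_rpow hf hp.le, lintegral_congr_ae (ae_restrict_of_ae hintegrand)] at hpow
  have hroot := ENNReal.rpow_le_rpow hpow (one_div_nonneg.2 hp.le)
  rw [ENNReal.mul_rpow_of_nonneg _ _ (one_div_nonneg.2 hp.le),
    ENNReal.mul_rpow_of_nonneg _ _ (one_div_nonneg.2 hp.le), ← ENNReal.rpow_mul,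
    ← ENNReal.rpow_mul, mul_one_div_cancel hp.ne', ENNReal.rpow_one, mul_one_div,
    ENNReal.ofReal_rpow_of_pos (Real.exp_pos _), ← Real.exp_mul, mul_one_div] at hroot
  rw [← ENNReal.mul_div_right_comm,
    ENNReal.le_div_iff_mul_le (Or.inl (by simp [hV])) (Or.inl (by simp [hV])), mul_comm]
  exact hroot

theorem lintegral_ofReal_log_ne_top {α : Type*} [MeasurableSpace α] {μ : Measure α} {g : α → ℝ}
    (hp : 0 < p) (hg : ∀ᵐ a ∂μ, 0 ≤ g a) (h : ∫⁻ a, ENNReal.ofReal (g a) ^ p ∂μ ≠ ⊤) :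
    ∫⁻ a, ENNReal.ofReal (Real.log (g a)) ∂μ ≠ ⊤ := by
  refine ne_top_of_le_ne_top (ENNReal.mul_ne_top (ENNReal.ofReal_ne_top (r := p⁻¹)) h) ?_
  rw [← lintegral_const_mul' _ _ ENNReal.ofReal_ne_top]
  refine lintegral_mono_ae (hg.mono fun a ha => ?_)
  rw [ENNReal.ofReal_rpow_of_nonneg ha hp.le, ← ENNReal.ofReal_mul (inv_nonneg.2 hp.le),
    inv_mul_eq_div]
  exact ENNReal.ofReal_le_ofReal (Real.log_le_rpow_div ha hp)

theorem geomMean_mul_le {g h : EuclideanSpace ℝ (Fin n) → ℝ} (hx : x ≠ 0) (hp : 0 < p)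
    (hs : 1 ≤ s) (hgm : AEMeasurable g volume) (hhm : AEMeasurable h volume)
    (hg : ∀ᵐ y ∂volume, 0 < g y) (hh : ∀ᵐ y ∂volume, 0 < h y)
    (hfin : ∫⁻ y, ENNReal.ofReal (g y) ^ p ≠ ⊤) :
    geomMean (fun y => g y * h y) x ≤ ENNReal.ofReal (Real.exp ((s - 1) / p)) *
      (geomMean h x / ENNReal.ofReal (ballVol volume x) ^ (s / p)) *
        (∫⁻ y in Metric.ball 0 ‖x‖, (ENNReal.ofReal (g y) *
          ENNReal.ofReal (ballVol volume y) ^ ((s - 1) / p)) ^ p) ^ (1 / p) := by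
  have hlog : ∫⁻ y in Metric.ball 0 ‖x‖, ENNReal.ofReal (Real.log (g y)) ≠ ⊤ :=
    lintegral_ofReal_log_ne_top hp (ae_restrict_of_ae (hg.mono fun y hy => hy.le))
      (ne_top_of_le_ne_top hfin (setLIntegral_le_lintegral _ _))
  rcases eq_or_ne (geomMean h x) ⊤ with htop | htop
  · have hint : (∫⁻ y in Metric.ball 0 ‖x‖, (ENNReal.ofReal (g y) *
        ENNReal.ofReal (ballVol volume y) ^ ((s - 1) / p)) ^ p) ^ (1 / p) ≠ 0 := by
      have : NeZero (volume.restrict (Metric.ball (0 : EuclideanSpace ℝ (Fin n)) ‖x‖)) :=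
        ⟨Measure.restrict_eq_zero.not.2 (Metric.measure_ball_pos _ _ (norm_pos_iff.2 hx)).ne'⟩
      have hmeas : AEMeasurable (fun y => (ENNReal.ofReal (g y) *
          ENNReal.ofReal (ballVol volume y) ^ ((s - 1) / p)) ^ p) volume :=
        (hgm.ennreal_ofReal.mul
          (measurable_ballVol.ennreal_ofReal.pow_const _).aemeasurable).pow_const p
      refine (ENNReal.rpow_pos_of_nonneg (lintegral_pos_of_ae_pos hmeas.restrict
        (ae_restrict_of_ae ?_)) (one_div_nonneg.2 hp.le)).ne'
      filter_upwards [hg, ae_ballVol_pos n] with y hgy hVy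
      positivity
    have hV : ENNReal.ofReal (ballVol volume x) ^ (s / p) ≠ ⊤ := by
      simp [(ENNReal.ofReal_pos.2 (ballVol_pos hx)).ne']
    rw [htop, ENNReal.top_div_of_ne_top hV, ENNReal.mul_top (by positivity),
      ENNReal.top_mul hint]
    exact le_top
  · rw [geomMean_mul hx hgm hhm hg hh hlog (Or.inr htop)]
    refine (mul_le_mul_left (geomMean_le_rpow_lintegral hx hp hs hgm hg) _).trans_eq ?_
    simp only [div_eq_mul_inv]
    ring

theorem geomMean_mul_le_rpow_lintegral_hardyKernel {l : ℝ≥0∞} (hx : x ≠ 0) (hp : 0 < p)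
    (hs : 1 ≤ s) (hfm : AEMeasurable f volume) (hf : ∀ᵐ y ∂volume, 0 < f y) (hv : IsWeight v)
    (hl : 0 < l) (hltop : l < ⊤) (hmod : ∫⁻ y, (‖f y‖ₑ * ENNReal.ofReal (v y) / l) ^ p ≠ ⊤) :
    geomMean f x * ENNReal.ofReal (w x) ≤ ENNReal.ofReal (Real.exp ((s - 1) / p)) * l *
      (∫⁻ y, hardyKernel s p v w x y ^ p ∂volume.withDensity
        fun y => (‖f y‖ₑ * ENNReal.ofReal (v y) / l) ^ p) ^ (1 / p) := by
  set φ : EuclideanSpace ℝ (Fin n) → ℝ≥0∞ := fun y => ‖f y‖ₑ * ENNReal.ofReal (v y) / l with hφ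
  have hφm : AEMeasurable φ volume :=
    (hfm.enorm.mul hv.aemeasurable.ennreal_ofReal).div_const l
  have hscale : (fun y => ENNReal.ofReal (f y * v y)) =ᵐ[volume] fun y => l * φ y :=
    hf.mono fun y hy => by
      simp only [hφ, ENNReal.mul_div_cancel hl.ne' hltop.ne, Real.enorm_of_nonneg hy.le,
        ENNReal.ofReal_mul hy.le]
  have hfin : ∫⁻ y, ENNReal.ofReal (f y * v y) ^ p ≠ ⊤ := by
    have hpow : (fun y => ENNReal.ofReal (f y * v y) ^ p) =ᵐ[volume] fun y => l ^ p * φ y ^ p :=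
      hscale.mono fun y hy => by simp only [hy, ENNReal.mul_rpow_of_nonneg _ _ hp.le]
    have hl_rpow : l ^ p ≠ ⊤ := ENNReal.rpow_ne_top_of_nonneg hp.le hltop.ne
    rw [lintegral_congr_ae hpow, lintegral_const_mul' _ _ hl_rpow]
    exact ENNReal.mul_ne_top hl_rpow hmod
  have hsplit : f =ᵐ[volume] fun y => f y * v y * (1 / v y) :=
    hv.ae_pos.mono fun y (hy : 0 < v y) => show f y = f y * v y * (1 / v y) by
      rw [mul_assoc, mul_one_div_cancel hy.ne', mul_one]
  have hbound := geomMean_mul_le (g := fun y => f y * v y) (h := fun y => 1 / v y) hx hp hs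
    (hfm.mul hv.aemeasurable) (hv.aemeasurable.const_div 1)
    (by filter_upwards [hf, hv.ae_pos] with y hfy hvy using mul_pos hfy hvy)
    (hv.ae_pos.mono fun y hy => one_div_pos.2 hy) hfin
  have hintegrand : (fun y => (ENNReal.ofReal (f y * v y) *
      ENNReal.ofReal (ballVol volume y) ^ ((s - 1) / p)) ^ p) =ᵐ[volume]
        fun y => (l * (φ y * ENNReal.ofReal (ballVol volume y) ^ ((s - 1) / p))) ^ p :=
    hscale.mono fun y hy => by simp only [hy, mul_assoc]
  rw [← geomMean_congr_ae hsplit, lintegral_congr_ae (ae_restrict_of_ae hintegrand),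
    lintegral_const_mul_rpow_one_div hp hltop.ne] at hbound
  rw [rpow_lintegral_hardyKernel_withDensity hp hφm]
  refine (mul_le_mul_left hbound _).trans_eq ?_
  simp only [hardyWeight, div_eq_mul_inv]
  ring

theorem luxNorm_geomMean_le {q : EuclideanSpace ℝ (Fin n) → ℝ} {l : ℝ≥0∞} (hp : 0 < p)
    (hs : 1 ≤ s) (hq : AEMeasurable q volume) (hpq : ∀ᵐ x ∂volume, p ≤ q x)
    (hfm : AEMeasurable f volume) (hf : ∀ᵐ y ∂volume, 0 < f y) (hv : IsWeight v)
    (hw : AEMeasurable w volume) (hl : 0 < l) (hltop : l < ⊤)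
    (hmod : ∫⁻ y, (‖f y‖ₑ * ENNReal.ofReal (v y) / l) ^ p ≤ 1) :
    luxNorm q w Set.univ (geomMean f) ≤
      ENNReal.ofReal (Real.exp ((s - 1) / p)) * condD s p q v w * l := by
  set ν := (volume : Measure (EuclideanSpace ℝ (Fin n))).withDensity
    fun y => (‖f y‖ₑ * ENNReal.ofReal (v y) / l) ^ p with hν
  have hq0 : ∀ᵐ x ∂volume, 0 < q x := hpq.mono fun x hx => hp.trans_le hx
  have hνuniv : ν Set.univ ≤ 1 := by rwa [hν, withDensity_apply _ .univ, Measure.restrict_univ]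
  have hkernel : ∀ᵐ y ∂ν,
      luxNorm q (fun _ => 1) Set.univ (fun x => hardyKernel s p v w x y) ≤ condD s p q v w :=
    (withDensity_absolutelyContinuous _ _).ae_le <| (Measure.ae_ne volume 0).mono fun y hy =>
      luxNorm_hardyKernel_le_condD hy hq0
  have hEl : ENNReal.ofReal (Real.exp ((s - 1) / p)) * l ≠ 0 :=
    mul_ne_zero (ENNReal.ofReal_pos.2 (Real.exp_pos _)).ne' hl.ne'
  have hEltop : ENNReal.ofReal (Real.exp ((s - 1) / p)) * l ≠ ⊤ :=
    ENNReal.mul_ne_top ENNReal.ofReal_ne_top hltop.ne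
  calc luxNorm q w Set.univ (geomMean f)
      ≤ luxNorm q (fun _ => 1) Set.univ fun x => ENNReal.ofReal (Real.exp ((s - 1) / p)) * l *
          (∫⁻ y, hardyKernel s p v w x y ^ p ∂ν) ^ (1 / p) := by
        rw [luxNorm_eq_luxNorm_one]
        refine luxNorm_mono_ae (hq0.mono fun x hx => hx.le) ?_
        filter_upwards [Measure.ae_ne volume 0] with x hx
        rw [ENNReal.ofReal_one, mul_one, mul_one]
        exact geomMean_mul_le_rpow_lintegral_hardyKernel hx hp hs hfm hf hv hl hltop
          (ne_top_of_le_ne_top ENNReal.one_ne_top hmod)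
    _ ≤ ENNReal.ofReal (Real.exp ((s - 1) / p)) * l * luxNorm q (fun _ => 1) Set.univ fun x =>
          (∫⁻ y, hardyKernel s p v w x y ^ p ∂ν) ^ (1 / p) := luxNorm_const_mul_le hEl hEltop
    _ ≤ ENNReal.ofReal (Real.exp ((s - 1) / p)) * l * condD s p q v w := by
        gcongr
        exact luxNorm_rpow_lintegral_rpow_le hνuniv hp hq hpq
          (aemeasurable_uncurry_hardyKernel hw) hkernel
    _ = ENNReal.ofReal (Real.exp ((s - 1) / p)) * condD s p q v w * l := mul_right_comm ..

theorem geomMeanInequality_of_exp_mul_condD_le {q : EuclideanSpace ℝ (Fin n) → ℝ} {C : ℝ≥0∞}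
    (hp : 0 < p) (hs : 1 ≤ s) (hq : AEMeasurable q volume) (hpq : ∀ᵐ x ∂volume, p ≤ q x)
    (hv : IsWeight v) (hw : AEMeasurable w volume) (hC0 : C ≠ 0) (hCtop : C ≠ ⊤)
    (hC : ENNReal.ofReal (Real.exp ((s - 1) / p)) * condD s p q v w ≤ C) :
    GeomMeanInequality p q v w C := by
  intro f hfm hf
  rw [luxNorm.eq_def (fun _ => p), sInf_eq_iInf', ENNReal.mul_iInf_of_ne hC0 hCtop]
  refine le_iInf fun ⟨l, hl, hltop, hmod⟩ => ?_
  rw [Measure.restrict_univ] at hmod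
  exact (luxNorm_geomMean_le hp hs hq hpq hfm (ae_of_all _ hf) hv hw hl hltop hmod).trans
    (mul_le_mul_left hC l)

theorem bestConst_le_exp_mul_condD {q : EuclideanSpace ℝ (Fin n) → ℝ} (hp : 0 < p) (hs : 1 ≤ s)
    (hq : AEMeasurable q volume) (hpq : ∀ᵐ x ∂volume, p ≤ q x) (hv : IsWeight v)
    (hw : AEMeasurable w volume) :
    bestConst p q v w ≤ ENNReal.ofReal (Real.exp ((s - 1) / p)) * condD s p q v w := by
  refine le_of_forall_gt_imp_ge_of_dense fun C hC => ?_
  rcases eq_or_ne C ⊤ with rfl | hCtop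
  · exact le_top
  have hC0 : C ≠ 0 := (zero_le.trans_lt hC).ne'
  exact sInf_le ⟨hC0.bot_lt, hCtop.lt_top,
    geomMeanInequality_of_exp_mul_condD_le hp hs hq hpq hv hw hC0 hCtop hC.le⟩

theorem exists_geomMeanInequality_of_condD_lt_top {q : EuclideanSpace ℝ (Fin n) → ℝ} (hp : 0 < p)
    (hs : 1 ≤ s) (hq : AEMeasurable q volume) (hpq : ∀ᵐ x ∂volume, p ≤ q x) (hv : IsWeight v)
    (hw : AEMeasurable w volume) (hD : condD s p q v w < ⊤) :
    ∃ C : ℝ≥0∞, 0 < C ∧ C < ⊤ ∧ GeomMeanInequality p q v w C := by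
  have hbest : bestConst p q v w < ⊤ := (bestConst_le_exp_mul_condD hp hs hq hpq hv hw).trans_lt
    (ENNReal.mul_lt_top ENNReal.ofReal_lt_top hD)
  obtain ⟨C, hC, -⟩ := sInf_lt_iff.1 hbest
  exact ⟨C, hC⟩

end UpperBound

section HardyProfile

variable {s T U u : ℝ}

/-- The profile of the functions that test the inequality from below: constant up to the volume
`T` and decaying like `u ^ (-s)` beyond it. The constants make the mean of its logarithm over
`(0, U)`, for `U ≥ T`, equal to `log (T ^ (s - 1) * U ^ (-s))`. -/
noncomputable def hardyProfile (s T u : ℝ) : ℝ :=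
  if u ≤ T then T⁻¹ else Real.exp (-s) * T ^ (s - 1) * u ^ (-s)

theorem hardyProfile_of_le (hu : u ≤ T) : hardyProfile s T u = T⁻¹ :=
  if_pos hu

theorem hardyProfile_of_lt (hu : T < u) :
    hardyProfile s T u = Real.exp (-s) * T ^ (s - 1) * u ^ (-s) :=
  if_neg hu.not_ge

theorem hardyProfile_pos (hT : 0 < T) : 0 < hardyProfile s T u := by
  rcases le_or_gt u T with hu | hu
  · rw [hardyProfile_of_le hu]
    positivity
  · have hu0 : 0 < u := hT.trans hu
    rw [hardyProfile_of_lt hu]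
    positivity

theorem measurable_hardyProfile (s T : ℝ) : Measurable (hardyProfile s T) :=
  Measurable.ite measurableSet_Iic measurable_const ((measurable_id.pow_const _).const_mul _)

theorem log_hardyProfile_of_lt (hT : 0 < T) (hu : T < u) :
    Real.log (hardyProfile s T u) = -s + (s - 1) * Real.log T - s * Real.log u := by
  have hu0 : 0 < u := hT.trans hu
  rw [hardyProfile_of_lt hu, Real.log_mul (by positivity) (by positivity),
    Real.log_mul (by positivity) (by positivity), Real.log_exp, Real.log_rpow hT,
    Real.log_rpow hu0]
  ring

theorem log_hardyProfile_eqOn_uIoc_left (hT : 0 < T) :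
    Set.EqOn (fun u => Real.log (hardyProfile s T u)) (fun _ => -Real.log T) (Set.uIoc 0 T) := by
  intro u hu
  rw [Set.uIoc_of_le hT.le] at hu
  simp only [hardyProfile_of_le hu.2, Real.log_inv]

theorem log_hardyProfile_eqOn_uIoc_right (hT : 0 < T) (hTU : T ≤ U) :
    Set.EqOn (fun u => Real.log (hardyProfile s T u))
      (fun u => -s + (s - 1) * Real.log T - s * Real.log u) (Set.uIoc T U) := by
  intro u hu
  rw [Set.uIoc_of_le hTU] at hu
  exact log_hardyProfile_of_lt hT hu.1

theorem intervalIntegrable_log_hardyProfile_left (hT : 0 < T) :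
    IntervalIntegrable (fun u => Real.log (hardyProfile s T u)) volume 0 T :=
  intervalIntegrable_const.congr (log_hardyProfile_eqOn_uIoc_left hT).symm

theorem intervalIntegrable_log_hardyProfile_right (hT : 0 < T) (hTU : T ≤ U) :
    IntervalIntegrable (fun u => Real.log (hardyProfile s T u)) volume T U :=
  (intervalIntegrable_const.sub (intervalIntegral.intervalIntegrable_log'.const_mul s)).congr
    (log_hardyProfile_eqOn_uIoc_right hT hTU).symm

theorem intervalIntegrable_log_hardyProfile (hT : 0 < T) (hTU : T ≤ U) :
    IntervalIntegrable (fun u => Real.log (hardyProfile s T u)) volume 0 U :=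
  (intervalIntegrable_log_hardyProfile_left hT).trans
    (intervalIntegrable_log_hardyProfile_right hT hTU)

theorem integral_log_hardyProfile (hT : 0 < T) (hTU : T ≤ U) :
    ∫ u in 0..U, Real.log (hardyProfile s T u) =
      U * ((s - 1) * Real.log T - s * Real.log U) := by
  rw [← intervalIntegral.integral_add_adjacent_intervals
      (intervalIntegrable_log_hardyProfile_left hT)
      (intervalIntegrable_log_hardyProfile_right hT hTU),
    intervalIntegral.integral_congr_ae (ae_of_all _ (log_hardyProfile_eqOn_uIoc_left hT)),
    intervalIntegral.integral_congr_ae (ae_of_all _ (log_hardyProfile_eqOn_uIoc_right hT hTU)),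
    intervalIntegral.integral_sub intervalIntegrable_const
      (intervalIntegral.intervalIntegrable_log'.const_mul s), intervalIntegral.integral_const,
    intervalIntegral.integral_const, intervalIntegral.integral_const_mul, integral_log,
    smul_eq_mul, smul_eq_mul]
  ring

theorem lintegral_hardyProfile_Ioc (hT : 0 < T) :
    ∫⁻ u in Set.Ioc 0 T, ENNReal.ofReal (hardyProfile s T u) = 1 := by
  have hconst : Set.EqOn (fun u => ENNReal.ofReal (hardyProfile s T u))
      (fun _ => ENNReal.ofReal T⁻¹) (Set.Ioc 0 T) := fun u hu => by
    simp only [hardyProfile_of_le hu.2]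
  rw [setLIntegral_congr_fun measurableSet_Ioc hconst, setLIntegral_const, Real.volume_Ioc,
    ← ENNReal.ofReal_mul (inv_nonneg.2 hT.le), sub_zero, inv_mul_cancel₀ hT.ne', ENNReal.ofReal_one]

theorem lintegral_hardyProfile_Ioi (hs : 1 < s) (hT : 0 < T) :
    ∫⁻ u in Set.Ioi T, ENNReal.ofReal (hardyProfile s T u) =
      ENNReal.ofReal (Real.exp (-s) / (s - 1)) := by
  have hpower : Set.EqOn (fun u => ENNReal.ofReal (hardyProfile s T u))
      (fun u => ENNReal.ofReal (Real.exp (-s) * T ^ (s - 1) * u ^ (-s))) (Set.Ioi T) :=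
    fun u hu => by simp only [hardyProfile_of_lt hu]
  have hnonneg : 0 ≤ᵐ[volume.restrict (Set.Ioi T)]
      fun u => Real.exp (-s) * T ^ (s - 1) * u ^ (-s) :=
    (ae_restrict_mem measurableSet_Ioi).mono fun u (hu : T < u) => by
      have hu0 : 0 < u := hT.trans hu
      simp only [Pi.zero_apply]
      positivity
  rw [setLIntegral_congr_fun measurableSet_Ioi hpower, ← ofReal_integral_eq_lintegral_ofReal
      ((integrableOn_Ioi_rpow_of_lt (neg_lt_neg hs) hT).const_mul _) hnonneg,
    integral_const_mul, integral_Ioi_rpow_of_lt (neg_lt_neg hs) hT]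
  have hcancel : T ^ (s - 1) * T ^ (-s + 1) = 1 := by
    rw [← Real.rpow_add hT, sub_add_add_cancel, add_neg_cancel, Real.rpow_zero]
  have hs1 : -s + 1 = -(s - 1) := by ring
  rw [mul_div_assoc', mul_neg, mul_assoc, hcancel, hs1, neg_div_neg_eq, mul_one]

theorem lintegral_hardyProfile (hs : 1 < s) (hT : 0 < T) :
    ∫⁻ u in Set.Ioi 0, ENNReal.ofReal (hardyProfile s T u) =
      ENNReal.ofReal (Real.exp (-s) * (Real.exp s + 1 / (s - 1))) := by
  have : 0 < s - 1 := sub_pos.2 hs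
  rw [← Set.Ioc_union_Ioi_eq_Ioi hT.le, lintegral_union measurableSet_Ioi
      (Set.Ioc_disjoint_Ioi le_rfl), lintegral_hardyProfile_Ioc hT,
    lintegral_hardyProfile_Ioi hs hT, ← ENNReal.ofReal_one,
    ← ENNReal.ofReal_add zero_le_one (by positivity), mul_add, ← Real.exp_add, neg_add_cancel,
    Real.exp_zero, mul_one_div]

end HardyProfile

section LowerBound

variable {n : ℕ} {s p T : ℝ} {q v w : EuclideanSpace ℝ (Fin n) → ℝ}
  {x : EuclideanSpace ℝ (Fin n)}

/-- The function `v⁻¹ φ(|B(0,|·|)|) ^ (1/p)`, with `φ` the Hardy profile, on which the geometric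
mean inequality is tested; it is set to `1` on the null set where `v` vanishes, so as to be
positive. -/
noncomputable def testFunction (s p T : ℝ) (v : EuclideanSpace ℝ (Fin n) → ℝ)
    (y : EuclideanSpace ℝ (Fin n)) : ℝ :=
  if 0 < v y then hardyProfile s T (ballVol volume y) ^ (1 / p) * (1 / v y) else 1

theorem testFunction_pos (hT : 0 < T) (y : EuclideanSpace ℝ (Fin n)) :
    0 < testFunction s p T v y := by
  have hprofile : 0 < hardyProfile s T (ballVol volume y) := hardyProfile_pos hT
  rw [testFunction]
  split_ifs <;> positivity

theorem testFunction_ae_eq (hv : IsWeight v) :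
    testFunction s p T v =ᵐ[volume]
      fun y => hardyProfile s T (ballVol volume y) ^ (1 / p) * (1 / v y) :=
  hv.ae_pos.mono fun _ hy => if_pos hy

theorem measurable_hardyProfile_ballVol :
    Measurable fun y : EuclideanSpace ℝ (Fin n) => hardyProfile s T (ballVol volume y) :=
  (measurable_hardyProfile s T).comp measurable_ballVol

theorem aemeasurable_testFunction (hv : IsWeight v) :
    AEMeasurable (testFunction s p T v) volume :=
  ((measurable_hardyProfile_ballVol.pow_const _).aemeasurable.mul
    (hv.aemeasurable.const_div 1)).congr (testFunction_ae_eq hv).symm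

variable [NeZero n]

theorem lintegral_testFunction (hp : 0 < p) (hs : 1 < s) (hT : 0 < T) (hv : IsWeight v) :
    ∫⁻ y, (‖testFunction s p T v y‖ₑ * ENNReal.ofReal (v y)) ^ p =
      ENNReal.ofReal (Real.exp (-s) * (Real.exp s + 1 / (s - 1))) := by
  rw [← lintegral_hardyProfile hs hT,
    ← map_ballVol (μ := (volume : Measure (EuclideanSpace ℝ (Fin n)))),
    lintegral_map (measurable_hardyProfile s T).ennreal_ofReal measurable_ballVol]
  refine lintegral_congr_ae ?_
  filter_upwards [hv.ae_pos, testFunction_ae_eq (s := s) (p := p) (T := T) hv] with y hvy hy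
  have hprofile : 0 < hardyProfile s T (ballVol volume y) := hardyProfile_pos hT
  rw [Real.enorm_of_nonneg (testFunction_pos hT y).le,
    ← ENNReal.ofReal_mul (testFunction_pos hT y).le, hy, mul_assoc,
    one_div_mul_cancel hvy.ne', mul_one, ENNReal.ofReal_rpow_of_pos (by positivity),
    ← Real.rpow_mul hprofile.le, one_div_mul_cancel hp.ne', Real.rpow_one]

theorem luxNorm_testFunction_le (hp : 0 < p) (hs : 1 < s) (hT : 0 < T) (hv : IsWeight v) :
    luxNorm (fun _ => p) v Set.univ (fun y => ‖testFunction s p T v y‖ₑ) ≤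
      ENNReal.ofReal (Real.exp (-s) * (Real.exp s + 1 / (s - 1))) ^ (1 / p) := by
  have : 0 < s - 1 := sub_pos.2 hs
  set M := ENNReal.ofReal (Real.exp (-s) * (Real.exp s + 1 / (s - 1))) with hM
  have hM0 : M ≠ 0 := (ENNReal.ofReal_pos.2 (by positivity)).ne'
  have hMtop : M ≠ ⊤ := ENNReal.ofReal_ne_top
  have hMp : (M ^ (1 / p)) ^ p = M := by
    rw [← ENNReal.rpow_mul, one_div_mul_cancel hp.ne', ENNReal.rpow_one]
  refine luxNorm_le (by positivity)
    (ENNReal.rpow_lt_top_of_nonneg (one_div_nonneg.2 hp.le) hMtop) ?_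
  simp only [Measure.restrict_univ, ENNReal.div_rpow_of_nonneg _ _ hp.le, hMp, div_eq_mul_inv _ M]
  rw [lintegral_mul_const' _ _ (ENNReal.inv_ne_top.2 hM0), lintegral_testFunction hp hs hT hv,
    ← hM, ENNReal.mul_inv_cancel hM0 hMtop]

theorem geomMean_hardyProfile (hT : 0 < T) (hTx : T ≤ ballVol volume x) :
    geomMean (fun y => hardyProfile s T (ballVol volume y)) x =
      ENNReal.ofReal (T ^ (s - 1) / ballVol volume x ^ s) := by
  have hV : 0 < ballVol volume x := hT.trans_le hTx
  rw [geomMean_comp_ballVol (intervalIntegrable_log_hardyProfile hT hTx),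
    integral_log_hardyProfile hT hTx, mul_div_cancel_left₀ _ hV.ne', Real.exp_sub,
    Real.rpow_def_of_pos hT, Real.rpow_def_of_pos hV, mul_comm s, mul_comm (s - 1)]

theorem geomMean_testFunction (hp : 0 < p) (hT : 0 < T) (hv : IsWeight v)
    (hTx : T ≤ ballVol volume x) :
    geomMean (testFunction s p T v) x =
      ENNReal.ofReal T ^ ((s - 1) / p) / ENNReal.ofReal (ballVol volume x) ^ (s / p) *
        geomMean (fun y => 1 / v y) x := by
  have hx : x ≠ 0 := by
    rintro rfl
    simp [ballVol, hT.not_ge] at hTx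
  have hV : 0 < ballVol volume x := hT.trans_le hTx
  have hpos : ∀ᵐ y : EuclideanSpace ℝ (Fin n), 0 < hardyProfile s T (ballVol volume y) :=
    ae_of_all _ fun y => hardyProfile_pos hT
  have hroot : geomMean (fun y => hardyProfile s T (ballVol volume y) ^ (1 / p)) x =
      ENNReal.ofReal T ^ ((s - 1) / p) / ENNReal.ofReal (ballVol volume x) ^ (s / p) := by
    rw [geomMean_rpow hpos (one_div_nonneg.2 hp.le), geomMean_hardyProfile hT hTx,
      ENNReal.ofReal_div_of_pos (by positivity),
      ENNReal.div_rpow_of_nonneg _ _ (one_div_nonneg.2 hp.le), ← ENNReal.ofReal_rpow_of_pos hT,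
      ← ENNReal.ofReal_rpow_of_pos hV, ← ENNReal.rpow_mul, ← ENNReal.rpow_mul, mul_one_div,
      mul_one_div]
  rw [geomMean_congr_ae (testFunction_ae_eq hv), ← hroot]
  refine geomMean_mul_of_ne_zero_of_ne_top hx
    (measurable_hardyProfile_ballVol.pow_const _).aemeasurable (hv.aemeasurable.const_div 1)
    (hpos.mono fun y hy => Real.rpow_pos_of_pos hy _) (hv.ae_pos.mono fun y hy => one_div_pos.2 hy)
    ?_ ?_ <;> rw [geomMean_rpow hpos (one_div_nonneg.2 hp.le), geomMean_hardyProfile hT hTx]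
  · positivity
  · exact ENNReal.rpow_ne_top_of_nonneg (one_div_nonneg.2 hp.le) ENNReal.ofReal_ne_top

theorem mul_luxNorm_hardyWeight_le (hp : 0 < p) (hv : IsWeight v)
    {t : ℝ} (ht : 0 < t) :
    volume (Metric.ball (0 : EuclideanSpace ℝ (Fin n)) t) ^ ((s - 1) / p) *
        luxNorm q (fun _ => 1) {x | t < ‖x‖} (hardyWeight s p v w) ≤
      luxNorm q w Set.univ (geomMean (testFunction s p
        (volume.real (Metric.ball (0 : EuclideanSpace ℝ (Fin n)) t)) v)) := by
  set T := volume.real (Metric.ball (0 : EuclideanSpace ℝ (Fin n)) t)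
  have hT0 : 0 < T := measureReal_ball_zero_pos ht
  have hvol : volume (Metric.ball (0 : EuclideanSpace ℝ (Fin n)) t) = ENNReal.ofReal T :=
    (ofReal_measureReal measure_ball_lt_top.ne).symm
  have hTne : ENNReal.ofReal T ≠ 0 := (ENNReal.ofReal_pos.2 hT0).ne'
  have hgeom : Set.EqOn
      (fun x => geomMean (testFunction s p T v) x * ENNReal.ofReal (w x))
      (fun x => ENNReal.ofReal T ^ ((s - 1) / p) * hardyWeight s p v w x) {x | t < ‖x‖} := by
    intro x hx
    have hTx : T ≤ ballVol volume x :=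
      not_lt.1 fun h => ((ballVol_lt_measureReal_ball ht.le).1 h).not_gt hx
    simp only [geomMean_testFunction hp hT0 hv hTx, hardyWeight, div_eq_mul_inv]
    ring
  calc _ = luxNorm q w {x | t < ‖x‖} (geomMean (testFunction s p T v)) := by
        rw [hvol, ← luxNorm_const_mul (by simp [hTne]) (by simp [hTne]),
          luxNorm_eq_luxNorm_one (w := w),
          luxNorm_congr (measurableSet_lt measurable_const measurable_norm) hgeom]
    _ ≤ luxNorm q w Set.univ (geomMean (testFunction s p T v)) :=
        luxNorm_mono_set (Set.subset_univ _)

theorem condD_le (hp : 0 < p) (hs : 1 < s) (hv : IsWeight v)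
    {C : ℝ≥0∞} (hC : GeomMeanInequality p q v w C) :
    condD s p q v w ≤
      C * ENNReal.ofReal (Real.exp (-s) * (Real.exp s + 1 / (s - 1))) ^ (1 / p) := by
  rw [condD_eq_iSup_luxNorm_hardyWeight]
  refine iSup₂_le fun t ht => ?_
  have hT : 0 < volume.real (Metric.ball (0 : EuclideanSpace ℝ (Fin n)) t) :=
    measureReal_ball_zero_pos ht
  calc _ ≤ luxNorm q w Set.univ (geomMean (testFunction s p
        (volume.real (Metric.ball (0 : EuclideanSpace ℝ (Fin n)) t)) v)) :=
        mul_luxNorm_hardyWeight_le hp hv ht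
    _ ≤ C * luxNorm (fun _ => p) v Set.univ fun y => ‖testFunction s p
        (volume.real (Metric.ball (0 : EuclideanSpace ℝ (Fin n)) t)) v y‖ₑ :=
        hC _ (aemeasurable_testFunction hv) (testFunction_pos hT)
    _ ≤ _ := by
        gcongr
        exact luxNorm_testFunction_le hp hs hT hv

theorem condD_lt_top (hp : 0 < p) (hs : 1 < s) (hv : IsWeight v)
    {C : ℝ≥0∞} (hCtop : C < ⊤) (hC : GeomMeanInequality p q v w C) :
    condD s p q v w < ⊤ :=
  (condD_le hp hs hv hC).trans_lt <| ENNReal.mul_lt_top hCtop <|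
    ENNReal.rpow_lt_top_of_nonneg (one_div_nonneg.2 hp.le) ENNReal.ofReal_ne_top

theorem mul_condD_le (hp : 0 < p) (hs : 1 < s) (hv : IsWeight v)
    {C : ℝ≥0∞} (hC : GeomMeanInequality p q v w C) :
    ENNReal.ofReal (Real.exp (s / p) / (Real.exp s + 1 / (s - 1)) ^ (1 / p)) *
      condD s p q v w ≤ C := by
  have : 0 < s - 1 := sub_pos.2 hs
  have hcancel : Real.exp (s / p) / (Real.exp s + 1 / (s - 1)) ^ (1 / p) *
      (Real.exp (-s) * (Real.exp s + 1 / (s - 1))) ^ (1 / p) = 1 := by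
    have hA : 0 < (Real.exp s + 1 / (s - 1)) ^ (1 / p) := by positivity
    rw [Real.mul_rpow (Real.exp_nonneg _) (by positivity), ← Real.exp_mul, ← mul_assoc,
      div_mul_eq_mul_div, div_mul_cancel₀ _ hA.ne', ← Real.exp_add, mul_one_div, neg_div,
      add_neg_cancel, Real.exp_zero]
  calc _ ≤ ENNReal.ofReal (Real.exp (s / p) / (Real.exp s + 1 / (s - 1)) ^ (1 / p)) *
        (C * ENNReal.ofReal (Real.exp (-s) * (Real.exp s + 1 / (s - 1))) ^ (1 / p)) := by
        gcongr
        exact condD_le hp hs hv hC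
    _ = C := by
        rw [mul_left_comm, ENNReal.ofReal_rpow_of_pos (by positivity),
          ← ENNReal.ofReal_mul (by positivity), hcancel, ENNReal.ofReal_one, mul_one]

end LowerBound

theorem one_le_ofReal_exponent_factor {α : Type*} [MeasurableSpace α] {μ : Measure α} [NeZero μ]
    {q : α → ℝ} {p Q : ℝ} (hp : 0 < p) (hpq : ∀ᵐ x ∂μ, p ≤ q x) (hqQ : ∀ᵐ x ∂μ, q x ≤ Q) :
    1 ≤ ENNReal.ofReal ((p / essInf q μ + (essSup q μ - p) / essSup q μ) ^ (2 / p)) := by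
  have hbelow : Filter.IsBoundedUnder (· ≥ ·) (ae μ) q := ⟨p, hpq⟩
  have habove : Filter.IsBoundedUnder (· ≤ ·) (ae μ) q := ⟨Q, hqQ⟩
  have hp_le : p ≤ essInf q μ := Filter.le_liminf_of_le habove.isCoboundedUnder_ge hpq
  have hinf_le : essInf q μ ≤ essSup q μ := Filter.liminf_le_limsup habove hbelow
  have hinf_pos : 0 < essInf q μ := hp.trans_le hp_le
  have hsup_pos : 0 < essSup q μ := hinf_pos.trans_le hinf_le
  refine ENNReal.one_le_ofReal.2 (Real.one_le_rpow ?_ (by positivity))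
  have hdiv : p / essSup q μ ≤ p / essInf q μ :=
    div_le_div_of_nonneg_left hp.le hinf_pos hinf_le
  rw [sub_div, div_self hsup_pos.ne']
  linarith

theorem iff_exists_mem {ι : Type*} {S : Set ι} {a : Prop} {b : ι → Prop} (hS : S.Nonempty)
    (h : ∀ s ∈ S, (a ↔ b s)) : a ↔ ∃ s ∈ S, b s :=
  ⟨fun ha => hS.imp fun s hs => ⟨hs, (h s hs).1 ha⟩, fun ⟨s, hs, hb⟩ => (h s hs).2 hb⟩

theorem theorem3_general (n : ℕ) (hn : 0 < n) (p : ℝ) (hp : 0 < p)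
    (q v w : EuclideanSpace ℝ (Fin n) → ℝ)
    (hq : AEMeasurable q volume)
    (hpq : ∀ᵐ x ∂(volume : Measure (EuclideanSpace ℝ (Fin n))), p ≤ q x)
    (hv : IsWeight v) (hw : AEMeasurable w volume) :
    (∀ s : ℝ, 1 < s →
      ((∃ C : ℝ≥0∞, 0 < C ∧ C < ⊤ ∧ GeomMeanInequality p q v w C) ↔ condD s p q v w < ⊤)) ∧
    (⨆ (s : ℝ) (_ : 1 < s),
        ENNReal.ofReal (Real.exp (s / p) / (Real.exp s + 1 / (s - 1)) ^ (1 / p)) *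
          condD s p q v w) ≤ bestConst p q v w ∧
    bestConst p q v w ≤
      ⨅ (s : ℝ) (_ : 1 < s), ENNReal.ofReal (Real.exp ((s - 1) / p)) * condD s p q v w := by
  have : NeZero n := ⟨hn.ne'⟩
  refine ⟨fun s hs => ⟨?_, ?_⟩, ?_, ?_⟩
  · rintro ⟨C, -, hCtop, hC⟩
    exact condD_lt_top hp hs hv hCtop hC
  · exact exists_geomMeanInequality_of_condD_lt_top hp hs.le hq hpq hv hw
  · exact iSup₂_le fun s hs => le_sInf fun C hC => mul_condD_le hp hs hv hC.2.2
  · exact le_iInf₂ fun s hs => bestConst_le_exp_mul_condD hp hs.le hq hpq hv hw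

theorem theorem3 (n : ℕ) (hn : 0 < n) (p Q : ℝ) (hp : 0 < p)
    (q v w : EuclideanSpace ℝ (Fin n) → ℝ)
    (hq : AEMeasurable q volume)
    (hpq : ∀ᵐ x ∂(volume : Measure (EuclideanSpace ℝ (Fin n))), p ≤ q x)
    (hqQ : ∀ᵐ x ∂(volume : Measure (EuclideanSpace ℝ (Fin n))), q x ≤ Q)
    (hv : IsWeight v) (hw : IsWeight w) :
    ((∃ C : ℝ≥0∞, 0 < C ∧ C < ⊤ ∧ GeomMeanInequality p q v w C) ↔
      ∃ s : ℝ, 1 < s ∧ condD s p q v w < ⊤) ∧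
    (1 < p →
      ((∃ C : ℝ≥0∞, 0 < C ∧ C < ⊤ ∧ GeomMeanInequality p q v w C) ↔
        ∃ s : ℝ, s ∈ Set.Ioo 1 p ∧ condD s p q v w < ⊤)) ∧
    (⨆ (s : ℝ) (_ : 1 < s),
        ENNReal.ofReal (Real.exp (s / p) / (Real.exp s + 1 / (s - 1)) ^ (1 / p)) *
          condD s p q v w) ≤ bestConst p q v w ∧
    bestConst p q v w ≤
      ENNReal.ofReal
        ((p / essInf q volume + (essSup q volume - p) / essSup q volume) ^ (2 / p)) *
        ⨅ (s : ℝ) (_ : 1 < s), ENNReal.ofReal (Real.exp ((s - 1) / p)) * condD s p q v w := by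
  obtain ⟨hiff, hlower, hupper⟩ := theorem3_general n hn p hp q v w hq hpq hv hw.aemeasurable
  exact ⟨iff_exists_mem Set.nonempty_Ioi hiff,
    fun hp1 => iff_exists_mem (Set.nonempty_Ioo.2 hp1) fun s hs => hiff s hs.1,
    hlower, hupper.trans (le_mul_of_one_le_left' (one_le_ofReal_exponent_factor hp hpq hqQ))⟩
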